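/- Notation. Let $\mathbb{R}\langle x_1,\dots,x_n\rangle$ be the algebra of real noncommutative polynomials, with the involution $*$ that fixes each $x_i$ and reverses words, and for $k\in\mathbb{N}\cup\{\infty\}$ let $\mathbb{R}\langle \mathbf{x}\rangle_k$ be the space of polynomials of degree at most $k$. A linear functional $L$ on $\mathbb{R}\langle\mathbf{x}\rangle_{2t}$ is symmetric if $L(w)=L(w^*)$ for all words $w$, and tracial if $L(vw)=L(wv)$ for all words $v,w$ with $|vw|\le 2t$. For $s\le t$ its moment matrix is $M_s(L)=(L(v^*w))_{|v|,|w|\le s}$, and $M(L)=M_\infty(L)$ if $t=\infty$. For $t\in\mathbb{N}$, $L$ is flat if $\operatorname{rank} M_t(L)=\operatorname{rank}M_{t-\delta}(L)$ for some integer $1\le\delta\le t$; for $t=\infty$, $L$ is flat if $\operatorname{rank}M(L)<\infty$. For a set $S$ of symmetric polynomials, $\mathcal{M}_{2t}(S)$ is the convex cone generated by the polynomials $p^*gp$ of degree at most $2t$ with $p\in\mathbb{R}\langle\mathbf{x}\rangle$ and $g\in S\cup\{1\}$. Let $A\in\mathbb{R}^{n\times n}$ be completely positive semidefinite, i.e.,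 $A=(\operatorname{Tr}(Y_i^*Y_j))_{i,j}$ for some Hermitian positive semidefinite matrices $Y_1,\dots,Y_n$ of the same size, and put $S_A=\{\sqrt{A_{11}}\,x_1-x_1^2,\dots,\sqrt{A_{nn}}\,x_n-x_n^2\}$. For $t\in\mathbb{N}\cup\{\infty\}$, $t\ge 1$, let $\xi_t^{\mathrm{cpsd}}(A)$ be the infimum of $L(1)$ over all symmetric tracial linear functionals $L$ on $\mathbb{R}\langle\mathbf{x}\rangle_{2t}$ with $L(x_ix_j)=A_{ij}$ for all $i,j$ and $L\ge 0$ on $\mathcal{M}_{2t}(S_A)$. Let $\xi_*^{\mathrm{cpsd}}(A)$ be the infimum obtained from the program for $t=\infty$ by adding the constraint $\operatorname{rank}M(L)<\infty$. Statement. (i) $\xi_*^{\mathrm{cpsd}}(A)$ equals the infimum of $L(1)$ over all linear functionals $L$ on $\mathbb{R}\langle\mathbf{x}\rangle$ with $A=(L(x_ix_j))$ that are conic combinations of trace evaluations $p\mapsto\operatorname{Re}\operatorname{Tr}(p(X_1,\dots,X_n))$ at tuples of Hermitian $d\times d$ matrices (with $d\ge 1$ arbitrary) such that $g(X_1,\dots,X_n)\succeq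 0$ for all $g\in S_A$. (ii) $\xi_*^{\mathrm{cpsd}}(A)$ equals the infimum over all $\alpha\ge 0$ for which there exist a finite dimensional $C^*$-algebra $\mathcal{A}$ with a tracial state $\tau$ and self-adjoint elements $X_1,\dots,X_n\in\mathcal{A}$ such that $g(X_1,\dots,X_n)$ is positive in $\mathcal A$ for all $g\in S_A$ and $A=\alpha\cdot(\tau(X_iX_j))_{i,j}$. (iii) For every $t\in\mathbb{N}\cup\{\infty\}$ with $t\ge1$: if the program defining $\xi_t^{\mathrm{cpsd}}(A)$ has an optimal solution that is flat, then $\xi_t^{\mathrm{cpsd}}(A)=\xi_*^{\mathrm{cpsd}}(A)$. -/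

import Mathlib

open scoped ComplexOrder

universe u

noncomputable section

namespace CPSD

/-- Words in the symbols `x₁, …, xₙ`; multiplication is concatenation, `star` is reversal. -/
abbrev Word (n : ℕ) : Type := FreeMonoid (Fin n)

/-- Noncommutative real polynomials in `x₁, …, xₙ`. The involution `star` fixes each variable
and reverses words. -/
abbrev NCPoly (n : ℕ) : Type := FreeAlgebra ℝ (Fin n)

/-- The variable `xᵢ`. -/
def var {n : ℕ} (i : Fin n) : NCPoly n := FreeAlgebra.ι ℝ i

/-- A word regarded as a polynomial. -/
def monomial {n : ℕ} : Word n →* NCPoly n := FreeMonoid.lift var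

/-- Polynomials of degree at most `k`: the linear combinations of words of length at most `k`. -/
def degLE (n : ℕ) (k : ℕ∞) : Submodule ℝ (NCPoly n) :=
  Submodule.span ℝ {p | ∃ w : Word n, (w.length : ℕ∞) ≤ k ∧ p = monomial w}

/-- Words of length at most `k`. -/
abbrev WordLE (n : ℕ) (k : ℕ∞) : Type := {w : Word n // (w.length : ℕ∞) ≤ k}

theorem monomial_mem {n : ℕ} {k : ℕ∞} {w : Word n} (h : (w.length : ℕ∞) ≤ k) :
    monomial w ∈ degLE n k :=
  Submodule.subset_span ⟨w, h, rfl⟩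

theorem one_mem {n : ℕ} {k : ℕ∞} : (1 : NCPoly n) ∈ degLE n k := by
  have h : monomial (1 : Word n) ∈ degLE n k := monomial_mem (by simp)
  rwa [map_one] at h

theorem length_star {n : ℕ} (w : Word n) : (star w).length = w.length := by
  show (List.reverse (FreeMonoid.toList w)).length = (FreeMonoid.toList w).length
  exact List.length_reverse

/-- Linear functionals on the polynomials of degree at most `k`. -/
abbrev Functional (n : ℕ) (k : ℕ∞) : Type := degLE n k →ₗ[ℝ] ℝ

/-- The value of a functional at a word in its domain. -/
def onWord {n : ℕ} {k : ℕ∞} (L : Functional n k) (w : Word n) (h : (w.length : ℕ∞) ≤ k) : ℝ :=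
  L ⟨monomial w, monomial_mem h⟩

/-- The value `L(1)`. -/
def atOne {n : ℕ} {k : ℕ∞} (L : Functional n k) : ℝ := L ⟨1, one_mem⟩

/-- `L(w) = L(w*)` for all words in the domain. -/
def IsSymmetric {n : ℕ} {k : ℕ∞} (L : Functional n k) : Prop :=
  ∀ (w : Word n) (h : (w.length : ℕ∞) ≤ k),
    onWord L w h = onWord L (star w) (by rwa [length_star])

/-- `L(vw) = L(wv)` for all words `v, w` with `vw` in the domain. -/
def IsTracial {n : ℕ} {k : ℕ∞} (L : Functional n k) : Prop :=
  ∀ (v w : Word n) (h : ((v * w).length : ℕ∞) ≤ k),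
    onWord L (v * w) h =
      onWord L (w * v) (by rwa [FreeMonoid.length_mul, add_comm, ← FreeMonoid.length_mul])

/-- The quadratic module of `S` truncated at degree `k`: the convex cone generated by the
polynomials `p* g p` of degree at most `k`, with `g ∈ S ∪ {1}`. -/
def quadModule {n : ℕ} (S : Set (NCPoly n)) (k : ℕ∞) : PointedCone ℝ (NCPoly n) :=
  PointedCone.hull ℝ
    {q | q ∈ degLE n k ∧ ∃ p : NCPoly n, ∃ g ∈ insert 1 S, q = star p * g * p}

/-- `L ≥ 0` on the truncated quadratic module of `S`. -/
def NonnegOnQuadModule {n : ℕ} {k : ℕ∞} (L : Functional n k) (S : Set (NCPoly n)) : Prop :=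
  ∀ q : degLE n k, (q : NCPoly n) ∈ quadModule S k → 0 ≤ L q

theorem length_star_mul_le {n : ℕ} {s t : ℕ∞} (hst : s ≤ t) (v w : WordLE n s) :
    ((star v.1 * w.1).length : ℕ∞) ≤ 2 * t := by
  rw [FreeMonoid.length_mul, length_star, Nat.cast_add, two_mul]
  exact add_le_add (v.2.trans hst) (w.2.trans hst)

/-- The moment matrix `M_s(L) = (L(v* w))`, with `v, w` ranging over the words of length at most
`s`, for a functional `L` on the polynomials of degree at most `2t` and `s ≤ t`. -/
def momentMatrix {n : ℕ} {t : ℕ∞} (L : Functional n (2 * t)) (s : ℕ∞) (hst : s ≤ t) :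
    Matrix (WordLE n s) (WordLE n s) ℝ :=
  Matrix.of fun v w => onWord L (star v.1 * w.1) (length_star_mul_le hst v w)

/-- `rank M(L) < ∞` for the full moment matrix (all words of length at most `t`). -/
def HasFiniteRank {n : ℕ} {t : ℕ∞} (L : Functional n (2 * t)) : Prop :=
  (momentMatrix L t le_rfl).eRank < ⊤

/-- `L` is `δ`-flat: `rank M_t(L) = rank M_{t-δ}(L)`. -/
def IsDeltaFlat {n : ℕ} {t : ℕ∞} (L : Functional n (2 * t)) (δ : ℕ) : Prop :=
  (momentMatrix L t le_rfl).eRank = (momentMatrix L (t - δ) tsub_le_self).eRank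

/-- Flatness. For finite `t`: `L` is `δ`-flat for some `1 ≤ δ ≤ t`.
For `t = ∞`: the moment matrix has finite rank. -/
def IsFlat {n : ℕ} {t : ℕ∞} (L : Functional n (2 * t)) : Prop :=
  (t = ⊤ ∧ HasFiniteRank L) ∨
    (t ≠ ⊤ ∧ ∃ δ : ℕ, 1 ≤ δ ∧ (δ : ℕ∞) ≤ t ∧ IsDeltaFlat L δ)

/-- The localizing polynomials `√Aᵢᵢ xᵢ - xᵢ²`. -/
def localizing {n : ℕ} (A : Matrix (Fin n) (Fin n) ℝ) : Set (NCPoly n) :=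
  Set.range fun i => Real.sqrt (A i i) • var i - var i ^ 2

/-- Feasibility for the program of order `t` (`t ∈ ℕ ∪ {∞}`, `t ≥ 1`). -/
structure Feasible {n : ℕ} (A : Matrix (Fin n) (Fin n) ℝ) {t : ℕ∞}
    (L : Functional n (2 * t)) : Prop where
  symmetric : IsSymmetric L
  tracial : IsTracial L
  moments : ∀ i j, ∃ h : var i * var j ∈ degLE n (2 * t), L ⟨var i * var j, h⟩ = A i j
  nonneg : NonnegOnQuadModule L (localizing A)

/-- The infimum of a set of real numbers in the extended reals (`+∞` for the empty set). -/
def extInf (s : Set ℝ) : EReal := sInf (Real.toEReal '' s)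

/-- The parameter `ξ_t^cpsd(A)` for `t ∈ ℕ ∪ {∞}`. -/
def xi {n : ℕ} (t : ℕ∞) (A : Matrix (Fin n) (Fin n) ℝ) : EReal :=
  extInf {r | ∃ L : Functional n (2 * t), Feasible A L ∧ r = atOne L}

/-- The parameter `ξ_*^cpsd(A)`: the program of order `∞` with the constraint
`rank M(L) < ∞` added. -/
def xiStar {n : ℕ} (A : Matrix (Fin n) (Fin n) ℝ) : EReal :=
  extInf {r | ∃ L : Functional n (2 * ⊤), Feasible A L ∧ HasFiniteRank L ∧ r = atOne L}

/-- `L` is an optimal solution of the program defining `ξ_t^cpsd(A)`. -/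
def IsOptimal {n : ℕ} (A : Matrix (Fin n) (Fin n) ℝ) {t : ℕ∞}
    (L : Functional n (2 * t)) : Prop :=
  Feasible A L ∧ ∀ L' : Functional n (2 * t), Feasible A L' → atOne L ≤ atOne L'

/-- Substitution of `X₁, …, Xₙ` for the variables. -/
def eval {n : ℕ} {B : Type*} [Ring B] [Algebra ℝ B] (X : Fin n → B) : NCPoly n →ₐ[ℝ] B :=
  FreeAlgebra.lift ℝ X

/-- The completely positive semidefinite cone: Gram matrices of tuples of Hermitian positive
semidefinite matrices for the trace inner product. -/
def IsCPSD {n : ℕ} (A : Matrix (Fin n) (Fin n) ℝ) : Prop :=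
  ∃ (d : ℕ) (X : Fin n → Matrix (Fin d) (Fin d) ℂ),
    (∀ i, (X i).PosSemidef) ∧ ∀ i j, (A i j : ℂ) = ((X i).conjTranspose * X j).trace

/-- The part of the matrix positivity domain of `S` in size `d`. -/
def matrixDomain {n : ℕ} (S : Set (NCPoly n)) (d : ℕ) :
    Set (Fin n → Matrix (Fin d) (Fin d) ℂ) :=
  {X | (∀ i, (X i).IsHermitian) ∧ ∀ g ∈ S, (eval X g).PosSemidef}

/-- The trace evaluation `p ↦ Re Tr p(X)`. -/
def traceEval {n d : ℕ} (X : Fin n → Matrix (Fin d) (Fin d) ℂ) : NCPoly n →ₗ[ℝ] ℝ :=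
  Complex.reLm ∘ₗ Matrix.traceLinearMap (Fin d) ℝ ℂ ∘ₗ (eval X).toLinearMap

/-- Conic combinations of trace evaluations at tuples in the matrix positivity domain of `S`
(matrices of arbitrary sizes `d ≥ 1`). -/
def conicTraceEvals {n : ℕ} (S : Set (NCPoly n)) : PointedCone ℝ (NCPoly n →ₗ[ℝ] ℝ) :=
  PointedCone.hull ℝ {L | ∃ d : ℕ, 1 ≤ d ∧ ∃ X ∈ matrixDomain S d, L = traceEval X}

/-- A tracial state on a unital C*-algebra. -/
structure IsTracialState {𝒜 : Type*} [CStarAlgebra 𝒜] (τ : 𝒜 →ₗ[ℂ] ℂ) : Prop where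
  nonneg : ∀ a, 0 ≤ τ (star a * a)
  map_one : τ 1 = 1
  tracial : ∀ a b, τ (a * b) = τ (b * a)

/-- The C*-algebraic positivity domain of `S`; an element is positive if it is of the form
`a* a`. -/
def cstarDomain {n : ℕ} (S : Set (NCPoly n)) (𝒜 : Type*) [CStarAlgebra 𝒜] : Set (Fin n → 𝒜) :=
  {X | (∀ i, star (X i) = X i) ∧ ∀ g ∈ S, ∃ a : 𝒜, eval X g = star a * a}

/-- There are a finite dimensional C*-algebra with tracial state `τ` and a tuple `X` in the
positivity domain of the localizing polynomials of `A` with `A = α · (τ(Xᵢ Xⱼ))`. -/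
def HasTracialRep {n : ℕ} (A : Matrix (Fin n) (Fin n) ℝ) (α : ℝ) : Prop :=
  ∃ (𝒜 : Type u) (_ : CStarAlgebra 𝒜) (_ : FiniteDimensional ℂ 𝒜) (τ : 𝒜 →ₗ[ℂ] ℂ),
    IsTracialState τ ∧ ∃ X ∈ cstarDomain (localizing A) 𝒜,
      ∀ i j, (A i j : ℂ) = α * τ (X i * X j)

end CPSD

end

/-! The infima in (i) and (ii) range over the same set of reals: a cycle of inclusions joins the
values at finite-rank solutions, at conic combinations of trace evaluations and at tracial
representations. The hard inclusion, `IsFlat.exists_conic`, holds for every flat feasible L, so it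
also gives (iii): the value of a flat optimal solution is attained in the finite-rank program, and
restricting functionals gives the other inequality.

For flat L the moment form is the Gram form of a map Φ onto some ℝ^d, and polynomials of degree at
most s, with s + 1 ≤ t, already fill ℝ^d. Left and right multiplication by x_i then act as symmetric
matrices X_i and R_i. Every R_i commutes with every X_j, and X_i Φ(1) = R_i Φ(1), so p ↦ ⟨Φ(1), p(X)
Φ(1)⟩ is tracial. It agrees with L at 1 and at all x_i x_j, which is all that is required.

On the *-algebra generated by the X_i this functional is a ↦ Tr(k a) with k in the algebra
(`vectorFunctional_mem_conicTraceEvals`). The density k is central, symmetric and positive, so its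
eigenspaces reduce the X_i, and the functional is the sum of the block traces weighted by the
eigenvalues.

Conversely, a conic combination is a positive trace on a direct sum of matrix algebras, and a
tracial representation has finite rank because its moments factor through a finite dimensional
algebra. -/

noncomputable section

namespace CPSD

open Matrix

/-! ### Involution, degree and evaluation of polynomials -/

section Polynomials

variable {n : ℕ}

theorem star_smul_ncPoly (r : ℝ) (p : NCPoly n) : star (r • p) = r • star p := by
  rw [Algebra.smul_def, star_mul, FreeAlgebra.star_algebraMap, Algebra.smul_def]
  exact (Algebra.commutes _ _).symm

/-- The involution as a real linear map. -/
def starLin : NCPoly n →ₗ[ℝ] NCPoly n where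
  toFun := star
  map_add' := star_add
  map_smul' := star_smul_ncPoly

@[simp] theorem starLin_apply (p : NCPoly n) : starLin p = star p := rfl

@[simp] theorem star_var (i : Fin n) : star (var i : NCPoly n) = var i := FreeAlgebra.star_ι i

@[simp] theorem monomial_of (i : Fin n) : monomial (FreeMonoid.of i) = var i :=
  FreeMonoid.lift_eval_of _ _

theorem star_monomial (w : Word n) : star (monomial w) = monomial (star w) := by
  induction w using FreeMonoid.inductionOn' with
  | one => simp
  | of_mul i w ih => simp [ih]

theorem degLE_mono {a b : ℕ∞} (h : a ≤ b) : degLE n a ≤ degLE n b :=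
  Submodule.span_mono fun _ ⟨w, hw, hp⟩ => ⟨w, hw.trans h, hp⟩

theorem mul_mem_degLE {a b c : ℕ∞} {p q : NCPoly n} (hp : p ∈ degLE n a) (hq : q ∈ degLE n b)
    (h : a + b ≤ c) : p * q ∈ degLE n c := by
  refine degLE_mono h ?_
  have : degLE n a * degLE n b ≤ degLE n (a + b) := by
    rw [degLE, degLE, Submodule.span_mul_span]
    refine Submodule.span_le.2 ?_
    rintro _ ⟨_, ⟨v, hv, rfl⟩, _, ⟨w, hw, rfl⟩, rfl⟩
    simp only [← map_mul]
    refine monomial_mem ?_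
    rw [FreeMonoid.length_mul, Nat.cast_add]
    exact add_le_add hv hw
  exact this (Submodule.mul_mem_mul hp hq)

theorem star_mem_degLE {a : ℕ∞} {p : NCPoly n} (hp : p ∈ degLE n a) : star p ∈ degLE n a := by
  have : degLE n a ≤ (degLE n a).comap starLin := by
    refine Submodule.span_le.2 ?_
    rintro _ ⟨w, hw, rfl⟩
    change star (monomial w) ∈ degLE n a
    rw [star_monomial]
    exact monomial_mem (by rwa [length_star])
  exact this hp

theorem var_mem_degLE {a : ℕ∞} (h : 1 ≤ a) (i : Fin n) : (var i : NCPoly n) ∈ degLE n a := by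
  rw [← monomial_of]
  exact monomial_mem (by simpa using h)

section Eval

variable {B : Type*} [Ring B] [Algebra ℝ B]

@[simp] theorem eval_var (X : Fin n → B) (i : Fin n) : eval X (var i) = X i :=
  FreeAlgebra.lift_ι_apply _ _

theorem eval_star [StarRing B] [StarModule ℝ B] {X : Fin n → B} (hX : ∀ i, star (X i) = X i)
    (p : NCPoly n) : eval X (star p) = star (eval X p) := by
  refine FreeAlgebra.induction ℝ (Fin n) (motive := fun p => eval X (star p) = star (eval X p))
    ?_ ?_ ?_ ?_ p
  · intro r
    rw [FreeAlgebra.star_algebraMap, AlgHom.commutes, ← algebraMap_star_comm, star_trivial]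
  · intro i
    exact (by simp [hX] : eval X (star (var i)) = star (eval X (var i)))
  · intro p q hp hq
    simp [hp, hq]
  · intro p q hp hq
    simp [hp, hq]

theorem map_eval {C : Type*} [Ring C] [Algebra ℝ C] (f : B →ₐ[ℝ] C) (X : Fin n → B)
    (p : NCPoly n) : f (eval X p) = eval (fun i => f (X i)) p := by
  have : f.comp (eval X) = eval (fun i => f (X i)) := by
    apply FreeAlgebra.hom_ext
    funext i
    simp [eval]
  exact DFunLike.congr_fun this p

end Eval

end Polynomials

/-! ### Gram representation of finite-rank forms -/

/-- A positive semidefinite form of finite rank is the Gram form of a linear map onto a Euclidean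
space. Finite rank is witnessed by a map of finite rank with smaller kernel. -/
theorem exists_gram_map {E F : Type*} [AddCommGroup E] [Module ℝ E] [AddCommGroup F] [Module ℝ F]
    (B : E →ₗ[ℝ] E →ₗ[ℝ] ℝ) (hsymm : ∀ p q, B p q = B q p) (hpos : ∀ p, 0 ≤ B p p)
    (c : E →ₗ[ℝ] F) [FiniteDimensional ℝ (LinearMap.range c)]
    (hc : LinearMap.ker c ≤ LinearMap.ker B) :
    ∃ (d : ℕ) (Φ : E →ₗ[ℝ] (Fin d → ℝ)), Function.Surjective Φ ∧
      ∀ p q, Φ p ⬝ᵥ Φ q = B p q := by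
  have hdef : ∀ p, B p p = 0 → B p = 0 := by
    intro p hp
    ext q
    by_contra hq
    have hq' : B p q ≠ 0 := hq
    have key : ∀ r : ℝ, 0 ≤ 2 * r * B p q + B q q := by
      intro r
      have := hpos (r • p + q)
      simp only [map_add, map_smul, LinearMap.add_apply, LinearMap.smul_apply, hp,
        smul_eq_mul, hsymm q p] at this
      linarith
    -- This `r` makes the expression in `key` equal to -1.
    have := key (-(B q q + 1) / (2 * B p q))
    have h2 : 2 * (-(B q q + 1) / (2 * B p q)) * B p q = -(B q q + 1) := by field_simp
    linarith
  obtain ⟨W, hW⟩ := Submodule.exists_isCompl (LinearMap.ker B)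
  -- A complement `W` of `ker B` meets `ker c` trivially, so `c` embeds it in a finite dimensional
  -- space; `B` is definite on `W` and serves as its inner product.
  have hinj : Function.Injective (c.rangeRestrict ∘ₗ W.subtype) := by
    rw [← LinearMap.ker_eq_bot, LinearMap.ker_eq_bot']
    intro w hw
    have hw' : c w = 0 := by simpa [Subtype.ext_iff] using hw
    have : (w : E) ∈ LinearMap.ker B ⊓ W := ⟨hc hw', w.2⟩
    rw [hW.inf_eq_bot] at this
    exact Subtype.ext this
  have : FiniteDimensional ℝ W := FiniteDimensional.of_injective _ hinj
  let core : InnerProductSpace.Core ℝ W :=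
    { inner := fun x y => B x y
      conj_inner_symm := fun x y => hsymm _ _
      re_inner_nonneg := fun x => hpos _
      add_left := fun x y z => by simp
      smul_left := fun x y r => by simp
      definite := fun x hx => by
        have : (x : E) ∈ LinearMap.ker B ⊓ W := ⟨hdef _ hx, x.2⟩
        rw [hW.inf_eq_bot] at this
        exact Subtype.ext this }
  let : NormedAddCommGroup W := core.toNormedAddCommGroup
  let : InnerProductSpace ℝ W := InnerProductSpace.ofCore core.toCore
  let e := (stdOrthonormalBasis ℝ W).repr
  let P : E →ₗ[ℝ] W := W.projectionOnto (LinearMap.ker B) hW.symm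
  refine ⟨Module.finrank ℝ W, (WithLp.linearEquiv 2 ℝ (Fin _ → ℝ)).toLinearMap ∘ₗ
    e.toLinearEquiv.toLinearMap ∘ₗ P, ?_, ?_⟩
  · exact (WithLp.linearEquiv 2 ℝ (Fin _ → ℝ)).surjective.comp
      (e.toLinearEquiv.surjective.comp (Submodule.projectionOnto_surjective hW.symm))
  · have hP : ∀ p, B (P p : E) = B p := by
      intro p
      have hmem : p - (P p : E) ∈ LinearMap.ker B := by
        rw [← Submodule.projectionOnto_apply_eq_zero_iff hW.symm, map_sub, sub_eq_zero]
        exact (Submodule.projectionOnto_apply_left hW.symm _).symm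
      exact (sub_eq_zero.1 (by simpa using hmem)).symm
    intro p q
    have h1 : inner ℝ (e (P p)) (e (P q)) = B (P p : E) (P q : E) := e.inner_map_map _ _
    rw [EuclideanSpace.inner_eq_star_dotProduct] at h1
    rw [← hP p, hsymm, ← hP q, hsymm, ← h1, dotProduct_comm]
    rfl

open scoped MatrixOrder in
theorem exists_eq_conjTranspose_mul_self {𝕜 ι : Type*} [RCLike 𝕜] [Fintype ι]
    {M : Matrix ι ι 𝕜} (hM : M.PosSemidef) : ∃ B : Matrix ι ι 𝕜, M = Bᴴ * B := by
  classical
  exact CStarAlgebra.nonneg_iff_eq_star_mul_self.mp hM.nonneg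

/-! ### The trace form on a *-closed real matrix algebra -/

section TraceForm

variable {ι : Type*} [Fintype ι] [DecidableEq ι]

theorem eq_zero_of_trace_mul_eq_zero {𝒜 : Subalgebra ℝ (Matrix ι ι ℝ)}
    (hstar : ∀ a ∈ 𝒜, aᴴ ∈ 𝒜) {y : Matrix ι ι ℝ} (hy : y ∈ 𝒜)
    (h : ∀ a ∈ 𝒜, (y * a).trace = 0) : y = 0 :=
  Matrix.trace_mul_conjTranspose_self_eq_zero_iff.1 (h _ (hstar y hy))

/-- The trace form is nondegenerate on a *-closed algebra, since pairing y with its adjoint gives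
the squared norm of y. In finite dimension it therefore represents every functional. -/
theorem exists_trace_density {𝒜 : Subalgebra ℝ (Matrix ι ι ℝ)} (hstar : ∀ a ∈ 𝒜, aᴴ ∈ 𝒜)
    (ℓ : Matrix ι ι ℝ →ₗ[ℝ] ℝ) : ∃ k ∈ 𝒜, ∀ a ∈ 𝒜, ℓ a = (k * a).trace := by
  let β : 𝒜 →ₗ[ℝ] Module.Dual ℝ 𝒜 :=
    ((LinearMap.mul ℝ (Matrix ι ι ℝ)).compr₂ (Matrix.traceLinearMap ι ℝ ℝ)).domRestrict₁₂
      (Subalgebra.toSubmodule 𝒜) (Subalgebra.toSubmodule 𝒜)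
  have hβ : ∀ a b : 𝒜, β a b = ((a : Matrix ι ι ℝ) * b).trace := fun a b => rfl
  have hinj : Function.Injective β := by
    rw [← LinearMap.ker_eq_bot, LinearMap.ker_eq_bot']
    intro y hy
    refine Subtype.ext (eq_zero_of_trace_mul_eq_zero hstar y.2 fun a ha => ?_)
    rw [← hβ y ⟨a, ha⟩, hy]
    rfl
  have hsurj : Function.Surjective β :=
    (LinearMap.injective_iff_surjective_of_finrank_eq_finrank
      Subspace.dual_finrank_eq.symm).1 hinj
  obtain ⟨k, hk⟩ := hsurj (ℓ ∘ₗ 𝒜.val.toLinearMap)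
  refine ⟨k, k.2, fun a ha => ?_⟩
  rw [← hβ k ⟨a, ha⟩, hk]
  rfl

theorem trace_conjStarAlgAut (u : unitary (Matrix ι ι ℝ)) (x : Matrix ι ι ℝ) :
    (Unitary.conjStarAlgAut ℝ (Matrix ι ι ℝ) u x).trace = x.trace := by
  rw [Unitary.conjStarAlgAut_apply, Matrix.trace_mul_comm, ← mul_assoc]
  simp

theorem aeval_diagonal (f : Polynomial ℝ) (μ : ι → ℝ) :
    Polynomial.aeval (diagonal μ) f = diagonal fun a => f.eval (μ a) := by
  have h := Polynomial.aeval_algHom_apply (Matrix.diagonalAlgHom (n := ι) (α := ℝ) ℝ) μ f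
  rw [Matrix.diagonalAlgHom_apply] at h
  rw [h, Matrix.diagonalAlgHom_apply]
  congr 1
  funext a
  have := Polynomial.aeval_algHom_apply (Pi.evalAlgHom ℝ (fun _ : ι => ℝ) a) μ f
  exact this.symm

theorem eigenvalues_nonneg_of_trace_nonneg {k : Matrix ι ι ℝ} (hk : k.IsHermitian)
    (h : ∀ f : Polynomial ℝ, 0 ≤ (k * (Polynomial.aeval k f * Polynomial.aeval k f)).trace)
    (a : ι) : 0 ≤ hk.eigenvalues a := by
  set μ := hk.eigenvalues
  set φ := Unitary.conjStarAlgAut ℝ (Matrix ι ι ℝ) hk.eigenvectorUnitary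
  have hφ : k = φ (diagonal μ) := hk.spectral_theorem
  -- By interpolation f(k) is the spectral projection for the eigenvalue at `a`; the trace in `h f`
  -- is that eigenvalue times its multiplicity.
  obtain ⟨f, hf⟩ := (Polynomial.exists_eval_eq_iff μ fun b => if μ b = μ a then (1 : ℝ) else 0).2
    fun i j hij => by simp [hij]
  have h1 : Polynomial.aeval k f = φ (diagonal fun b => f.eval (μ b)) := by
    rw [hφ, ← aeval_diagonal]
    exact Polynomial.aeval_algHom_apply (φ : Matrix ι ι ℝ →ₐ[ℝ] Matrix ι ι ℝ) _ f
  have h2 := h f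
  rw [h1] at h2
  nth_rewrite 1 [hφ] at h2
  rw [← map_mul, ← map_mul, trace_conjStarAlgAut, diagonal_mul_diagonal, diagonal_mul_diagonal,
    trace_diagonal] at h2
  by_contra hneg
  push Not at hneg
  refine absurd h2 (not_le.2 (Finset.sum_neg' (fun b _ => ?_) ⟨a, Finset.mem_univ a, ?_⟩))
  · rw [hf]
    split_ifs with hb
    · rw [hb]; linarith
    · simp
  · rw [hf]
    simpa using hneg

end TraceForm

/-! ### Splitting a weighted trace into blocks -/

section Blocks

variable {n d m : ℕ}

/-- Rows indexed by the block vanish outside it, so products can be computed inside the block. The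
product case needs the vanishing, hence the joint induction. -/
theorem eval_submatrix_of_invariant {Y : Fin n → Matrix (Fin d) (Fin d) ℝ} {f : Fin m → Fin d}
    (hf : Function.Injective f) (hY : ∀ i, ∀ x, ∀ b ∉ Set.range f, Y i (f x) b = 0)
    (p : NCPoly n) :
    (∀ x, ∀ b ∉ Set.range f, eval Y p (f x) b = 0) ∧
      eval (fun i => (Y i).submatrix f f) p = (eval Y p).submatrix f f := by
  classical
  refine FreeAlgebra.induction ℝ (Fin n) (motive := fun p =>
    (∀ x, ∀ b ∉ Set.range f, eval Y p (f x) b = 0) ∧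
      eval (fun i => (Y i).submatrix f f) p = (eval Y p).submatrix f f) ?_ ?_ ?_ ?_ p
  · intro r
    refine ⟨fun x b hb => ?_, ?_⟩
    · rw [AlgHom.commutes, Matrix.algebraMap_eq_diagonal, diagonal_apply_ne]
      rintro rfl
      exact hb ⟨x, rfl⟩
    · rw [AlgHom.commutes, AlgHom.commutes, Matrix.algebraMap_eq_diagonal,
        Matrix.algebraMap_eq_diagonal, Matrix.submatrix_diagonal _ _ hf]
      rfl
  · intro i
    change (∀ x, ∀ b ∉ Set.range f, eval Y (var i) (f x) b = 0) ∧
      eval (fun i => (Y i).submatrix f f) (var i) = (eval Y (var i)).submatrix f f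
    simp only [eval_var, and_true]
    exact hY i
  · rintro p q ⟨hp, hp'⟩ ⟨hq, hq'⟩
    have key : ∀ x b, (eval Y p * eval Y q) (f x) b =
        ∑ z, eval Y p (f x) (f z) * eval Y q (f z) b := by
      intro x b
      rw [Matrix.mul_apply, ← Finset.sum_image (s := Finset.univ) (g := f)
        (f := fun c => eval Y p (f x) c * eval Y q c b) (fun _ _ _ _ h => hf h)]
      refine (Finset.sum_subset (Finset.subset_univ _) fun c _ hc => ?_).symm
      rw [hp x c (by simpa using hc), zero_mul]
    refine ⟨fun x b hb => ?_, ?_⟩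
    · rw [map_mul, key]
      exact Finset.sum_eq_zero fun z _ => by rw [hq z b hb, mul_zero]
    · rw [map_mul, map_mul, hp', hq']
      ext x y
      rw [Matrix.submatrix_apply, key, Matrix.mul_apply]
      rfl
  · rintro p q ⟨hp, hp'⟩ ⟨hq, hq'⟩
    refine ⟨fun x b hb => ?_, ?_⟩
    · rw [map_add, Matrix.add_apply, hp x b hb, hq x b hb, add_zero]
    · rw [map_add, map_add, hp', hq']
      rfl

theorem posSemidef_map_ofReal {M : Matrix (Fin m) (Fin m) ℝ} (hM : M.PosSemidef) :
    (M.map Complex.ofReal).PosSemidef := by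
  obtain ⟨B, rfl⟩ := exists_eq_conjTranspose_mul_self hM
  have : (Bᴴ * B).map Complex.ofReal = (B.map Complex.ofReal)ᴴ * B.map Complex.ofReal := by
    refine (Matrix.map_mul (f := Complex.ofRealHom)).trans ?_
    change Bᴴ.map Complex.ofReal * B.map Complex.ofReal = _
    congr 1
    ext i j
    simp
  rw [this]
  exact Matrix.posSemidef_conjTranspose_mul_self _

theorem eval_map_ofReal (Y : Fin n → Matrix (Fin m) (Fin m) ℝ) (p : NCPoly n) :
    eval (fun i => (Y i).map Complex.ofReal) p = (eval Y p).map Complex.ofReal :=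
  (map_eval (Complex.ofRealAm.mapMatrix) Y p).symm

/-- A block of a real matrix tuple gives a trace evaluation. -/
theorem exists_traceEval_submatrix {S : Set (NCPoly n)} {Y : Fin n → Matrix (Fin d) (Fin d) ℝ}
    (hYh : ∀ i, (Y i).IsHermitian) (hS : ∀ g ∈ S, (eval Y g).PosSemidef) {f : Fin m → Fin d}
    (hf : Function.Injective f) (hY : ∀ i, ∀ x, ∀ b ∉ Set.range f, Y i (f x) b = 0) :
    ∃ X ∈ matrixDomain S m, ∀ p, traceEval X p = ∑ x, eval Y p (f x) (f x) := by
  have he : ∀ p, eval (fun i => ((Y i).submatrix f f).map Complex.ofReal) p =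
      ((eval Y p).submatrix f f).map Complex.ofReal := fun p => by
    rw [eval_map_ofReal, (eval_submatrix_of_invariant hf hY p).2]
  refine ⟨fun i => ((Y i).submatrix f f).map Complex.ofReal, ⟨fun i => ?_, fun g hg => ?_⟩,
    fun p => ?_⟩
  · ext x y
    have := congrFun (congrFun (hYh i) (f x)) (f y)
    simp only [conjTranspose_apply, star_trivial] at this
    simp [this]
  · rw [he]
    exact posSemidef_map_ofReal ((hS g hg).submatrix f)
  · change Complex.re (Matrix.trace (eval _ p)) = _
    rw [he]
    simp [Matrix.trace]

/-- A matrix commuting with `diagonal μ` is block diagonal along the level sets of `μ`, so the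
weighted trace is the sum of the block traces times the values of `μ`. -/
theorem trace_diagonal_mem_conicTraceEvals {S : Set (NCPoly n)}
    {Y : Fin n → Matrix (Fin d) (Fin d) ℝ} (hYh : ∀ i, (Y i).IsHermitian)
    (hS : ∀ g ∈ S, (eval Y g).PosSemidef) {μ : Fin d → ℝ} (hμ : ∀ a, 0 ≤ μ a)
    (hcomm : ∀ i, diagonal μ * Y i = Y i * diagonal μ) (L : NCPoly n →ₗ[ℝ] ℝ)
    (hL : ∀ p, L p = (diagonal μ * eval Y p).trace) : L ∈ conicTraceEvals S := by
  -- Only values taken by `μ` are used, which keeps each block of size at least 1.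
  have hblock : ∀ r ∈ Finset.univ.image μ, ∃ T ∈ conicTraceEvals S,
      ∀ p, T p = ∑ a with μ a = r, eval Y p a a := by
    intro r hr
    obtain ⟨a₀, -, ha₀⟩ := Finset.mem_image.1 hr
    let e := Fintype.equivFin {a // μ a = r}
    let f : Fin (Fintype.card {a // μ a = r}) → Fin d := fun x => (e.symm x).1
    have hfr : ∀ b, b ∈ Set.range f ↔ μ b = r := by
      intro b
      refine ⟨?_, fun hb => ⟨e ⟨b, hb⟩, by simp [f]⟩⟩
      rintro ⟨x, rfl⟩
      exact (e.symm x).2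
    obtain ⟨X, hX, hXp⟩ := exists_traceEval_submatrix (f := f) hYh hS
      (Subtype.val_injective.comp e.symm.injective) fun i x b hb => by
        have h := congrFun (congrFun (hcomm i) (f x)) b
        rw [diagonal_mul, mul_diagonal, (hfr _).1 ⟨x, rfl⟩] at h
        rw [hfr] at hb
        have h' : (r - μ b) * Y i (f x) b = 0 := by rw [sub_mul, h]; ring
        exact (mul_eq_zero.1 h').resolve_left (sub_ne_zero.2 (Ne.symm hb))
    refine ⟨traceEval X, PointedCone.subset_hull
      ⟨_, Fintype.card_pos_iff.2 ⟨⟨a₀, ha₀⟩⟩, X, hX, rfl⟩, fun p => ?_⟩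
    rw [hXp, Finset.sum_subtype (p := fun a => μ a = r) _ (by simp)]
    exact Equiv.sum_comp e.symm fun a : {a // μ a = r} => eval Y p a a
  choose! T hT hTp using hblock
  have hsum : L = ∑ r ∈ Finset.univ.image μ, r • T r := by
    ext1 p
    rw [hL, LinearMap.sum_apply, Matrix.trace,
      ← Finset.sum_fiberwise_of_maps_to (g := μ) (t := Finset.univ.image μ)
        fun a _ => Finset.mem_image_of_mem _ (Finset.mem_univ a)]
    refine Finset.sum_congr rfl fun r hr => ?_
    rw [LinearMap.smul_apply, hTp r hr, smul_eq_mul, Finset.mul_sum]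
    refine Finset.sum_congr rfl fun a ha => ?_
    rw [diag_apply, diagonal_mul, (Finset.mem_filter.1 ha).2]
  rw [hsum]
  refine sum_mem fun r hr => ?_
  obtain ⟨a, -, rfl⟩ := Finset.mem_image.1 hr
  exact PointedCone.smul_mem _ (hμ a) (hT _ hr)

end Blocks

/-! ### Tracial vector functionals are conic combinations of traces -/

/-- The functional `p ↦ ⟨v, p(X) v⟩`. -/
def vectorFunctional {n d : ℕ} (X : Fin n → Matrix (Fin d) (Fin d) ℝ) (v : Fin d → ℝ) :
    NCPoly n →ₗ[ℝ] ℝ where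
  toFun p := v ⬝ᵥ (eval X p *ᵥ v)
  map_add' p q := by simp [add_mulVec, dotProduct_add]
  map_smul' r p := by simp [smul_mulVec, dotProduct_smul]

theorem vectorFunctional_mem_conicTraceEvals {n d : ℕ} {S : Set (NCPoly n)}
    {X : Fin n → Matrix (Fin d) (Fin d) ℝ} {v : Fin d → ℝ} (hX : ∀ i, (X i).IsHermitian)
    (htr : ∀ p q, vectorFunctional X v (p * q) = vectorFunctional X v (q * p))
    (hS : ∀ g ∈ S, (eval X g).PosSemidef) : vectorFunctional X v ∈ conicTraceEvals S := by
  have hev : ∀ p, eval X (star p) = (eval X p)ᴴ := eval_star hX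
  have hstar : ∀ a ∈ (eval X).range, aᴴ ∈ (eval X).range := by
    rintro _ ⟨p, rfl⟩
    exact ⟨star p, hev p⟩
  let ℓ : Matrix (Fin d) (Fin d) ℝ →ₗ[ℝ] ℝ :=
    { toFun := fun a => v ⬝ᵥ (a *ᵥ v)
      map_add' := fun p q => by simp [add_mulVec, dotProduct_add]
      map_smul' := fun r p => by simp [smul_mulVec, dotProduct_smul] }
  obtain ⟨k, hk, hkℓ⟩ := exists_trace_density hstar ℓ
  have hkp : ∀ p, vectorFunctional X v p = (k * eval X p).trace := fun p => hkℓ _ ⟨p, rfl⟩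
  -- The commutator lies in the algebra, and traciality makes it orthogonal to the whole algebra.
  have hcomm : ∀ a ∈ (eval X).range, k * a = a * k := by
    intro a ha
    refine sub_eq_zero.1 (eq_zero_of_trace_mul_eq_zero hstar
      (sub_mem (mul_mem hk ha) (mul_mem ha hk)) fun b hb => ?_)
    obtain ⟨p, rfl⟩ := ha
    obtain ⟨q, rfl⟩ := hb
    have h1 : (k * (eval X p * eval X q)).trace = (k * (eval X q * eval X p)).trace := by
      have := htr p q
      rwa [hkp, hkp, map_mul, map_mul] at this
    change ((k * eval X p - eval X p * k) * eval X q).trace = 0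
    rw [sub_mul, trace_sub, mul_assoc, h1, mul_assoc (eval X p), trace_mul_comm (eval X p),
      mul_assoc, sub_self]
  have hkh : k.IsHermitian := by
    refine sub_eq_zero.1 (eq_zero_of_trace_mul_eq_zero hstar
      (sub_mem (hstar k hk) hk) fun b hb => ?_)
    obtain ⟨p, rfl⟩ := hb
    change ((kᴴ - k) * eval X p).trace = 0
    have h1 : (kᴴ * eval X p).trace = (k * eval X (star p)).trace := by
      rw [hev, ← star_trivial (k * (eval X p)ᴴ).trace, ← trace_conjTranspose,
        conjTranspose_mul, conjTranspose_conjTranspose, trace_mul_comm]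
    rw [sub_mul, trace_sub, h1, ← hkp, ← hkp, sub_eq_zero]
    change v ⬝ᵥ (eval X (star p) *ᵥ v) = v ⬝ᵥ (eval X p *ᵥ v)
    rw [hev, dotProduct_mulVec, dotProduct_comm, conjTranspose_eq_transpose_of_trivial,
      vecMul_transpose]
  -- Since k lies in the algebra, so does f(k), and the trace is ℓ(f(k)²) = ‖f(k) v‖².
  have hpos : ∀ f : Polynomial ℝ,
      0 ≤ (k * (Polynomial.aeval k f * Polynomial.aeval k f)).trace := by
    intro f
    have hf : Polynomial.aeval k f ∈ (eval X).range := by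
      have := (Polynomial.aeval (⟨k, hk⟩ : (eval X).range) f).2
      rwa [← Subalgebra.coe_val, ← Polynomial.aeval_algHom_apply] at this
    have hfh : (Polynomial.aeval k f)ᴴ = Polynomial.aeval k f := by
      clear hf
      induction f using Polynomial.induction_on' with
      | add f g hf hg => rw [map_add, conjTranspose_add, hf, hg]
      | monomial j r =>
        rw [Polynomial.aeval_monomial, Algebra.algebraMap_eq_smul_one, smul_one_mul,
          conjTranspose_smul, conjTranspose_pow, hkh.eq, star_trivial]
    rw [← hkℓ _ (mul_mem hf hf)]
    nth_rewrite 1 [← hfh]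
    change 0 ≤ v ⬝ᵥ (_ *ᵥ v)
    rw [← mulVec_mulVec, dotProduct_mulVec, vecMul_conjTranspose]
    simpa using dotProduct_star_self_nonneg (Polynomial.aeval k f *ᵥ v)
  -- Passing to an eigenbasis of k makes the density diagonal and preserves traces and positivity.
  set μ := hkh.eigenvalues
  set φ := Unitary.conjStarAlgAut ℝ (Matrix (Fin d) (Fin d) ℝ) hkh.eigenvectorUnitary
  have hφ : k = φ (diagonal μ) := hkh.spectral_theorem
  have heY : ∀ p, eval (fun i => φ.symm (X i)) p = φ.symm (eval X p) := fun p =>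
    (map_eval (φ.symm : Matrix (Fin d) (Fin d) ℝ →ₐ[ℝ] Matrix (Fin d) (Fin d) ℝ) X p).symm
  refine trace_diagonal_mem_conicTraceEvals (Y := fun i => φ.symm (X i)) (μ := μ) ?_ ?_
    (eigenvalues_nonneg_of_trace_nonneg hkh hpos) ?_ _ ?_
  · intro i
    change star (φ.symm (X i)) = φ.symm (X i)
    rw [← map_star]
    exact congrArg _ (hX i)
  · intro g hg
    rw [heY]
    obtain ⟨B, hB⟩ := exists_eq_conjTranspose_mul_self (hS g hg)
    rw [hB, map_mul, ← star_eq_conjTranspose, map_star]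
    exact Matrix.posSemidef_conjTranspose_mul_self _
  · intro i
    have hinj : Function.Injective φ := EquivLike.injective φ
    apply hinj
    rw [map_mul, map_mul, ← hφ, StarAlgEquiv.apply_symm_apply]
    exact hcomm _ ⟨var i, eval_var X i⟩
  · intro p
    rw [hkp, heY, ← trace_conjStarAlgAut hkh.eigenvectorUnitary (diagonal μ * _)]
    change _ = (φ (diagonal μ * φ.symm (eval X p))).trace
    rw [map_mul, ← hφ, StarAlgEquiv.apply_symm_apply]

/-! ### Feasibility under restriction to lower degree -/

section Restriction

variable {n : ℕ} {A : Matrix (Fin n) (Fin n) ℝ}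

theorem quadModule_mono (S : Set (NCPoly n)) {a b : ℕ∞} (h : a ≤ b) :
    quadModule S a ≤ quadModule S b :=
  Submodule.span_mono fun _ ⟨hq, h'⟩ => ⟨degLE_mono h hq, h'⟩

theorem feasible_domRestrict {t : ℕ∞} (ht : 1 ≤ t) (M : NCPoly n →ₗ[ℝ] ℝ)
    (hstar : ∀ p, M (star p) = M p) (htr : ∀ p q, M (p * q) = M (q * p))
    (hmom : ∀ i j, M (var i * var j) = A i j)
    (hpos : ∀ p, ∀ g ∈ insert 1 (localizing A), 0 ≤ M (star p * g * p)) :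
    Feasible A (M.domRestrict (degLE n (2 * t))) where
  symmetric w h := by
    change M (monomial w) = M (monomial (star w))
    rw [← star_monomial, hstar]
  tracial v w h := by
    change M (monomial (v * w)) = M (monomial (w * v))
    rw [map_mul monomial, map_mul monomial, htr]
  moments i j := ⟨mul_mem_degLE (var_mem_degLE ht i) (var_mem_degLE ht j) (two_mul t).ge, hmom i j⟩
  nonneg q hq := by
    change 0 ≤ M q
    generalize (q : NCPoly n) = q at hq
    induction hq using Submodule.span_induction with
    | mem q hq =>
      obtain ⟨-, p, g, hg, rfl⟩ := hq
      exact hpos p g hg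
    | zero => simp
    | add p q _ _ hp hq => rw [map_add]; exact add_nonneg hp hq
    | smul r q _ hq =>
      change 0 ≤ M ((r : ℝ) • q)
      rw [map_smul]
      exact mul_nonneg r.2 hq

theorem Feasible.restrict {s t : ℕ∞} (hs : 1 ≤ s) (hst : s ≤ t) {L : Functional n (2 * t)}
    (hL : Feasible A L) : ∃ L' : Functional n (2 * s), Feasible A L' ∧ atOne L' = atOne L := by
  have hle : 2 * s ≤ 2 * t := mul_le_mul_right hst 2
  refine ⟨L ∘ₗ Submodule.inclusion (degLE_mono hle), ⟨fun w h => hL.symmetric w (h.trans hle),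
    fun v w h => hL.tracial v w (h.trans hle), fun i j => ?_, fun q hq => ?_⟩, rfl⟩
  · exact ⟨mul_mem_degLE (var_mem_degLE hs i) (var_mem_degLE hs j) (two_mul s).ge,
      (hL.moments i j).2⟩
  · exact hL.nonneg _ (quadModule_mono _ hle hq)

end Restriction

theorem eRank_lt_top_iff {m k : Type*} (M : Matrix m k ℝ) :
    M.eRank < ⊤ ↔ FiniteDimensional ℝ (Submodule.span ℝ (Set.range M.col)) := by
  rw [Matrix.eRank, Cardinal.toENat_lt_top, Matrix.cRank, Module.rank_lt_aleph0_iff]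

/-! ### Positive functionals on C*-algebras -/

section PositiveTrace

variable {𝒜 : Type*} [CStarAlgebra 𝒜] {τ : 𝒜 →ₗ[ℂ] ℂ}

/-- Polarization: reality of τ(b* b) at b = 1 + a fixes the imaginary part of τ(a*), and at b = 1 +
ia its real part. -/
theorem map_star_of_nonneg (hτ : ∀ a, 0 ≤ τ (star a * a)) (a : 𝒜) :
    τ (star a) = star (τ a) := by
  have him : ∀ b, (τ (star b * b)).im = 0 := fun b => (Complex.nonneg_iff.1 (hτ b)).2.symm
  have h1 := him 1
  have h2 := him a
  have h3 := him (1 + a)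
  have h4 := him (1 + Complex.I • a)
  simp only [star_add, star_one, star_smul, add_mul, mul_add, one_mul, mul_one, map_add,
    map_smul, smul_mul_assoc, mul_smul_comm, Complex.add_im, smul_eq_mul,
    Complex.star_def, Complex.conj_I, Complex.mul_im, Complex.neg_re, Complex.neg_im,
    Complex.mul_re, Complex.I_re, Complex.I_im] at h1 h2 h3 h4
  apply Complex.ext
  · simp only [Complex.star_def, Complex.conj_re]
    linarith
  · simp only [Complex.star_def, Complex.conj_im]
    linarith

/-- When τ(1) = 0, positivity at r·1 + b is affine in the real number r, so its slope 2 Re τ(b) must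
vanish. -/
theorem eq_zero_of_map_one_eq_zero (hτ : ∀ a, 0 ≤ τ (star a * a)) (h : τ 1 = 0) (a : 𝒜) :
    τ a = 0 := by
  have hre : ∀ b, (τ b).re = 0 := by
    intro b
    by_contra hb
    have key : ∀ r : ℝ, 0 ≤ 2 * r * (τ b).re + (τ (star b * b)).re := by
      intro r
      have h1 := (Complex.nonneg_iff.1 (hτ ((r : ℂ) • 1 + b))).1
      have h2 := congrArg Complex.re (map_star_of_nonneg hτ b)
      simp only [star_add, star_one, star_smul, add_mul, mul_add, one_mul, mul_one, map_add,
        map_smul, smul_mul_assoc, mul_smul_comm, Complex.add_re, smul_eq_mul, h,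
        mul_zero, Complex.star_def, Complex.conj_ofReal, Complex.re_ofReal_mul, zero_add, Complex.conj_re] at h1 h2
      rw [h2] at h1
      linarith
    have h1 := key (-((τ (star b * b)).re + 1) / (2 * (τ b).re))
    have h2 : 2 * (-((τ (star b * b)).re + 1) / (2 * (τ b).re)) * (τ b).re =
      -((τ (star b * b)).re + 1) := by field_simp
    linarith
  refine Complex.ext (hre a) ?_
  have := hre (Complex.I • a)
  simpa using this

end PositiveTrace

/-! ### Tracial representations and conic combinations -/

section Representations

variable {n : ℕ} {A : Matrix (Fin n) (Fin n) ℝ}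

theorem zero_mem_cstarDomain {𝒜 : Type*} [CStarAlgebra 𝒜] :
    (0 : Fin n → 𝒜) ∈ cstarDomain (localizing A) 𝒜 := by
  refine ⟨fun i => star_zero _, ?_⟩
  rintro _ ⟨i, rfl⟩
  exact ⟨0, by simp⟩

theorem feasible_of_hasTracialRep {α : ℝ} (hα : 0 ≤ α) (h : HasTracialRep.{u} A α) :
    ∃ L : Functional n (2 * ⊤), Feasible A L ∧ HasFiniteRank L ∧ α = atOne L := by
  obtain ⟨𝒜, _, hfin, τ, hτ, X, ⟨hX, hXg⟩, hA⟩ := h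
  let N : 𝒜 →ₗ[ℝ] ℝ := α • (Complex.reLm ∘ₗ τ.restrictScalars ℝ)
  have hN : ∀ a, N a = α * (τ a).re := fun a => rfl
  let M : NCPoly n →ₗ[ℝ] ℝ := N ∘ₗ (eval X).toLinearMap
  have hM : ∀ p, M p = α * (τ (eval X p)).re := fun a => rfl
  refine ⟨M.domRestrict _, feasible_domRestrict le_top M ?_ ?_ ?_ ?_, ?_, ?_⟩
  · intro p
    rw [hM, hM, eval_star hX, map_star_of_nonneg hτ.nonneg]
    rfl
  · intro p q
    rw [hM, hM, map_mul (eval X), map_mul (eval X), hτ.tracial]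
  · intro i j
    rw [hM, map_mul (eval X), eval_var, eval_var]
    simpa using (congrArg Complex.re (hA i j)).symm
  · intro p g hg
    obtain ⟨a, ha⟩ : ∃ a : 𝒜, eval X g = star a * a := by
      rcases hg with rfl | hg
      · exact ⟨1, by simp⟩
      · exact hXg g hg
    rw [hM, map_mul (eval X), map_mul (eval X), eval_star hX, ha]
    have : star (eval X p) * (star a * a) * eval X p = star (a * eval X p) * (a * eval X p) := by
      rw [star_mul]
      noncomm_ring
    rw [this]
    exact mul_nonneg hα (Complex.nonneg_iff.1 (hτ.nonneg _)).1
  · have : FiniteDimensional ℝ 𝒜 := FiniteDimensional.complexToReal 𝒜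
    rw [HasFiniteRank, eRank_lt_top_iff]
    -- Every column of the moment matrix is the image under `T` of an element of the finite
    -- dimensional algebra.
    let T : 𝒜 →ₗ[ℝ] (WordLE n ⊤ → ℝ) := LinearMap.pi fun v =>
      N ∘ₗ LinearMap.mulLeft ℝ (eval X (monomial (star v.1)))
    refine Submodule.finiteDimensional_of_le (S₂ := LinearMap.range T) (Submodule.span_le.2 ?_)
    rintro _ ⟨w, rfl⟩
    refine ⟨eval X (monomial w.1), ?_⟩
    funext v
    change N (eval X (monomial (star v.1)) * eval X (monomial w.1)) =
      N (eval X (monomial (star v.1 * w.1)))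
    rw [map_mul monomial, map_mul (eval X)]
  · change α = M 1
    rw [hM, map_one (eval X), hτ.map_one]
    simp

/-- Functions from a one-point type in universe `u` to the algebra form a copy of it in that
universe. -/
theorem HasTracialRep.lift {α : ℝ} (h : HasTracialRep.{0} A α) : HasTracialRep.{u} A α := by
  obtain ⟨𝒜, _, hfin, τ, hτ, X, ⟨hX, hXg⟩, hA⟩ := h
  refine ⟨PUnit.{u + 1} → 𝒜, inferInstance, inferInstance,
    τ ∘ₗ LinearMap.proj (φ := fun _ => 𝒜) PUnit.unit,
    ⟨fun a => hτ.nonneg _, hτ.map_one, fun a b => hτ.tracial _ _⟩,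
    fun i _ => X i, ⟨fun i => funext fun _ => hX i, fun g hg => ?_⟩, hA⟩
  obtain ⟨a, ha⟩ := hXg g hg
  refine ⟨fun _ => a, funext fun x => ?_⟩
  exact (map_eval (Pi.evalAlgHom ℝ (fun _ : PUnit => 𝒜) x) (fun i _ => X i) g).trans ha

/-- Leaving τ unnormalised lets sums become direct sums of algebras and multiples become rescalings
of τ. -/
theorem exists_trace_of_mem_conicTraceEvals {L : NCPoly n →ₗ[ℝ] ℝ}
    (hL : L ∈ conicTraceEvals (localizing A)) :
    ∃ (𝒜 : Type) (_ : CStarAlgebra 𝒜) (_ : FiniteDimensional ℂ 𝒜) (τ : 𝒜 →ₗ[ℂ] ℂ),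
      (∀ a, 0 ≤ τ (star a * a)) ∧ (∀ a b, τ (a * b) = τ (b * a)) ∧
        ∃ X ∈ cstarDomain (localizing A) 𝒜, ∀ p, L p = (τ (eval X p)).re := by
  induction hL using Submodule.span_induction with
  | mem L hL =>
    obtain ⟨d, -, X, ⟨hX, hXg⟩, rfl⟩ := hL
    refine ⟨Matrix (Fin d) (Fin d) ℂ, Matrix.instCStarAlgebra, inferInstance,
      Matrix.traceLinearMap (Fin d) ℂ ℂ, fun a => ?_, Matrix.trace_mul_comm, X,
      ⟨hX, fun g hg => ?_⟩, fun p => rfl⟩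
    · exact (Matrix.posSemidef_conjTranspose_mul_self a).trace_nonneg
    · exact exists_eq_conjTranspose_mul_self (hXg g hg)
  | zero =>
    exact ⟨ℂ, inferInstance, inferInstance, 0, by simp, by simp, 0, zero_mem_cstarDomain, by simp⟩
  | add L L' _ _ h h' =>
    obtain ⟨𝒜, _, _, τ, hτ, htr, X, ⟨hX, hXg⟩, hL⟩ := h
    obtain ⟨ℬ, _, _, σ, hσ, hstr, Y, ⟨hY, hYg⟩, hL'⟩ := h'
    have h1 : ∀ p, (eval (fun i => (X i, Y i)) p).1 = eval X p :=
      map_eval (AlgHom.fst ℝ 𝒜 ℬ) fun i => (X i, Y i)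
    have h2 : ∀ p, (eval (fun i => (X i, Y i)) p).2 = eval Y p :=
      map_eval (AlgHom.snd ℝ 𝒜 ℬ) fun i => (X i, Y i)
    refine ⟨𝒜 × ℬ, inferInstance, inferInstance, τ.coprod σ, fun a => ?_, fun a b => ?_,
      fun i => (X i, Y i), ⟨fun i => Prod.ext (hX i) (hY i), fun g hg => ?_⟩, fun p => ?_⟩
    · exact add_nonneg (hτ a.1) (hσ a.2)
    · exact congrArg₂ (· + ·) (htr a.1 b.1) (hstr a.2 b.2)
    · obtain ⟨a, ha⟩ := hXg g hg
      obtain ⟨b, hb⟩ := hYg g hg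
      exact ⟨(a, b), Prod.ext ((h1 g).trans ha) ((h2 g).trans hb)⟩
    · rw [LinearMap.add_apply, hL, hL', ← Complex.add_re]
      exact congrArg Complex.re (congrArg₂ (fun a b => τ a + σ b) (h1 p) (h2 p)).symm
  | smul r L _ h =>
    obtain ⟨𝒜, _, _, τ, hτ, htr, X, hX, hL⟩ := h
    refine ⟨𝒜, inferInstance, inferInstance, ((r : ℝ) : ℂ) • τ, fun a => ?_, fun a b => ?_, X, hX,
      fun p => ?_⟩
    · exact mul_nonneg (by exact_mod_cast r.2) (hτ a)
    · exact congrArg (((r : ℝ) : ℂ) * ·) (htr a b)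
    · change (r : ℝ) * L p = (((r : ℝ) : ℂ) * τ (eval X p)).re
      rw [Complex.re_ofReal_mul, hL]

theorem hasTracialRep_of_mem_conicTraceEvals {L : NCPoly n →ₗ[ℝ] ℝ}
    (hL : L ∈ conicTraceEvals (localizing A)) (hA : ∀ i j, A i j = L (var i * var j)) :
    0 ≤ L 1 ∧ HasTracialRep.{u} A (L 1) := by
  obtain ⟨𝒜, _, _, τ, hτ, htr, X, hX, hLτ⟩ := exists_trace_of_mem_conicTraceEvals hL
  have h1 : 0 ≤ τ 1 := by simpa using hτ 1
  have h1' : τ 1 = (L 1 : ℂ) := by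
    rw [hLτ, map_one (eval X)]
    exact Complex.ext rfl (Complex.nonneg_iff.1 h1).2.symm
  have hmom : ∀ i j, (A i j : ℂ) = τ (X i * X j) := by
    intro i j
    -- `L` records only real parts; self-adjointness and traciality show that this value is real.
    have him : star (τ (X i * X j)) = τ (X i * X j) := by
      rw [← map_star_of_nonneg hτ, star_mul, hX.1, hX.1, htr]
    rw [hA, hLτ, map_mul (eval X), eval_var, eval_var]
    exact Complex.conj_eq_iff_re.1 him
  have hL1 : 0 ≤ L 1 := by
    rw [h1'] at h1
    exact_mod_cast h1
  refine ⟨hL1, HasTracialRep.lift ?_⟩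
  -- If L(1) = 0 then τ = 0 cannot be normalised, but A = 0 and the zero tuple in ℂ serves.
  rcases hL1.eq_or_lt with h0 | h0
  · refine ⟨ℂ, inferInstance, inferInstance, LinearMap.id, ⟨fun a => ?_, rfl, mul_comm⟩, 0,
      zero_mem_cstarDomain, fun i j => ?_⟩
    · exact star_mul_self_nonneg a
    · rw [hmom, eq_zero_of_map_one_eq_zero hτ (by rw [h1', ← h0]; simp)]
      simp
  · have hne : (L 1 : ℂ) ≠ 0 := by exact_mod_cast h0.ne'
    refine ⟨𝒜, inferInstance, inferInstance, (((L 1)⁻¹ : ℝ) : ℂ) • τ, ⟨fun a => ?_, ?_, fun a b => ?_⟩,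
      X, hX, fun i j => ?_⟩
    · exact mul_nonneg (by exact_mod_cast (inv_pos.2 h0).le) (hτ a)
    · simp [h1', hne]
    · simp [htr a b]
    · simp [hmom, hne]

end Representations

/-! ### Gram maps of feasible functionals and flatness -/

section Extension

variable {n : ℕ} {A : Matrix (Fin n) (Fin n) ℝ} {t : ℕ∞}

/-- A linear functional on all polynomials that is tracial, symmetric and nonnegative on the
quadratic module as far as the degrees are at most `2t`. -/
structure TruncatedFeasible (A : Matrix (Fin n) (Fin n) ℝ) (t : ℕ∞) (M : NCPoly n →ₗ[ℝ] ℝ) :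
    Prop where
  star_eq : ∀ p ∈ degLE n (2 * t), M (star p) = M p
  mul_comm : ∀ (a b : ℕ∞), a + b ≤ 2 * t → ∀ p ∈ degLE n a, ∀ q ∈ degLE n b,
    M (p * q) = M (q * p)
  moments : ∀ i j, M (var i * var j) = A i j
  nonneg : ∀ p, ∀ g ∈ insert 1 (localizing A), star p * g * p ∈ degLE n (2 * t) →
    0 ≤ M (star p * g * p)

/-- Extending to all polynomials avoids carrying degree proofs in terms; values outside degree 2t
are arbitrary. The conditions on words spread to polynomials by linearity in each factor. -/
theorem Feasible.exists_extension {L : Functional n (2 * t)} (hL : Feasible A L) :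
    ∃ M : NCPoly n →ₗ[ℝ] ℝ, TruncatedFeasible A t M ∧
      ∀ p (h : p ∈ degLE n (2 * t)), M p = L ⟨p, h⟩ := by
  obtain ⟨M, hM⟩ := LinearMap.exists_extend L
  have hML : ∀ p (h : p ∈ degLE n (2 * t)), M p = L ⟨p, h⟩ := fun p h =>
    DFunLike.congr_fun hM ⟨p, h⟩
  refine ⟨M, ⟨fun p hp => ?_, fun a b hab p hp q hq => ?_, fun i j => ?_, fun p g hg h => ?_⟩, hML⟩
  · have hle : degLE n (2 * t) ≤ LinearMap.eqLocus (M ∘ₗ starLin) M := by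
      refine Submodule.span_le.2 ?_
      rintro _ ⟨w, hw, rfl⟩
      change M (star (monomial w)) = M (monomial w)
      rw [star_monomial, hML _ (monomial_mem hw),
        hML _ (monomial_mem (by rwa [length_star]))]
      exact (hL.symmetric w hw).symm
    exact hle hp
  · have hword : ∀ v w : Word n, (v.length : ℕ∞) ≤ a → (w.length : ℕ∞) ≤ b →
        M (monomial v * monomial w) = M (monomial w * monomial v) := by
      intro v w hv hw
      have h1 : ((v * w).length : ℕ∞) ≤ 2 * t := by
        rw [FreeMonoid.length_mul, Nat.cast_add]
        exact (add_le_add hv hw).trans hab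
      have h2 : ((w * v).length : ℕ∞) ≤ 2 * t := by
        rwa [FreeMonoid.length_mul, add_comm, ← FreeMonoid.length_mul]
      rw [← map_mul monomial, ← map_mul monomial, hML _ (monomial_mem h1),
        hML _ (monomial_mem h2)]
      exact hL.tracial v w h1
    have hle : ∀ w : Word n, (w.length : ℕ∞) ≤ b → degLE n a ≤ LinearMap.eqLocus
        (M ∘ₗ LinearMap.mulRight ℝ (monomial w)) (M ∘ₗ LinearMap.mulLeft ℝ (monomial w)) := by
      intro w hw
      refine Submodule.span_le.2 ?_
      rintro _ ⟨v, hv, rfl⟩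
      exact hword v w hv hw
    have hle' : degLE n b ≤ LinearMap.eqLocus
        (M ∘ₗ LinearMap.mulLeft ℝ p) (M ∘ₗ LinearMap.mulRight ℝ p) := by
      refine Submodule.span_le.2 ?_
      rintro _ ⟨w, hw, rfl⟩
      exact hle w hw hp
    exact hle' hq
  · obtain ⟨h, hij⟩ := hL.moments i j
    rw [hML _ h, hij]
  · rw [hML _ h]
    exact hL.nonneg _ (PointedCone.subset_hull ⟨h, p, g, hg, rfl⟩)

theorem TruncatedFeasible.symm {M : NCPoly n →ₗ[ℝ] ℝ} (hM : TruncatedFeasible A t M)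
    {p q : NCPoly n} (hp : p ∈ degLE n t) (hq : q ∈ degLE n t) :
    M (star p * q) = M (star q * p) := by
  rw [← hM.star_eq _ (mul_mem_degLE (star_mem_degLE hp) hq (two_mul t).ge), star_mul, star_star]

/-- The linear extension of the moment matrix, evaluated against words of length at most `s`. -/
def momentMap (M : NCPoly n →ₗ[ℝ] ℝ) (s : ℕ∞) : NCPoly n →ₗ[ℝ] (WordLE n s → ℝ) :=
  LinearMap.pi fun v => M ∘ₗ LinearMap.mulLeft ℝ (star (monomial v.1))

theorem map_momentMap_degLE {M : NCPoly n →ₗ[ℝ] ℝ} {L : Functional n (2 * t)}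
    (hML : ∀ p (h : p ∈ degLE n (2 * t)), M p = L ⟨p, h⟩) {s : ℕ∞} (hst : s ≤ t) :
    (degLE n s).map (momentMap M s) =
      Submodule.span ℝ (Set.range (momentMatrix L s hst).col) := by
  rw [degLE, Submodule.map_span]
  have hcol : ∀ w : WordLE n s, momentMap M s (monomial w.1) = (momentMatrix L s hst).col w := by
    intro w
    funext v
    change M (star (monomial v.1) * monomial w.1) =
      onWord L (star v.1 * w.1) (length_star_mul_le hst v w)
    rw [star_monomial, ← map_mul monomial, hML _ (monomial_mem (length_star_mul_le hst v w))]
    rfl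
  congr 1
  ext x
  constructor
  · rintro ⟨_, ⟨w, hw, rfl⟩, rfl⟩
    exact ⟨⟨w, hw⟩, (hcol ⟨w, hw⟩).symm⟩
  · rintro ⟨w, rfl⟩
    exact ⟨_, ⟨w.1, w.2, rfl⟩, hcol w⟩

/-- A factorization of a functional through a Euclidean space, compatible with the involution. -/
def IsGram (M : NCPoly n →ₗ[ℝ] ℝ) (t : ℕ∞) {d : ℕ} (Φ : NCPoly n →ₗ[ℝ] (Fin d → ℝ)) : Prop :=
  ∀ p ∈ degLE n t, ∀ q ∈ degLE n t, Φ p ⬝ᵥ Φ q = M (star p * q)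

/-- Words span, so a polynomial killed by `momentMap` is null for the moment form; the form thus has
finite rank. -/
theorem TruncatedFeasible.exists_isGram {M : NCPoly n →ₗ[ℝ] ℝ} (hM : TruncatedFeasible A t M)
    (hfin : FiniteDimensional ℝ ((degLE n t).map (momentMap M t))) :
    ∃ (d : ℕ) (Φ : NCPoly n →ₗ[ℝ] (Fin d → ℝ)), IsGram M t Φ ∧ (degLE n t).map Φ = ⊤ := by
  let B : degLE n t →ₗ[ℝ] degLE n t →ₗ[ℝ] ℝ :=
    (((LinearMap.mul ℝ (NCPoly n)).comp starLin).compr₂ M).domRestrict₁₂ (degLE n t) (degLE n t)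
  have hB : ∀ p q : degLE n t, B p q = M (star (p : NCPoly n) * q) := fun p q => rfl
  have hsymm : ∀ p q, B p q = B q p := fun p q => hM.symm p.2 q.2
  let c := (momentMap M t).domRestrict (degLE n t)
  have hc : LinearMap.range c = (degLE n t).map (momentMap M t) := LinearMap.range_domRestrict _ _
  have : FiniteDimensional ℝ (LinearMap.range c) := by rwa [hc]
  have hpos : ∀ p, 0 ≤ B p p := by
    intro p
    have := hM.nonneg p 1 (Set.mem_insert _ _)
    rw [mul_one] at this
    exact this (mul_mem_degLE (star_mem_degLE p.2) p.2 (two_mul t).ge)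
  have hker : LinearMap.ker c ≤ LinearMap.ker B := by
    intro p hp
    have hle : degLE n t ≤ LinearMap.ker (M ∘ₗ LinearMap.mulRight ℝ (p : NCPoly n) ∘ₗ starLin) := by
      refine Submodule.span_le.2 ?_
      rintro _ ⟨w, hw, rfl⟩
      exact congrFun (LinearMap.mem_ker.1 hp) ⟨w, hw⟩
    refine LinearMap.mem_ker.2 (LinearMap.ext fun q => ?_)
    rw [hsymm]
    exact hle q.2
  obtain ⟨d, Φ, hΦ, hΦB⟩ := exists_gram_map B hsymm hpos c hker
  obtain ⟨Ψ, hΨ⟩ := LinearMap.exists_extend Φ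
  have hΨΦ : ∀ p (h : p ∈ degLE n t), Ψ p = Φ ⟨p, h⟩ := fun p h =>
    DFunLike.congr_fun hΨ ⟨p, h⟩
  refine ⟨d, Ψ, fun p hp q hq => ?_, ?_⟩
  · rw [hΨΦ p hp, hΨΦ q hq, hΦB, hB]
  · rw [Submodule.eq_top_iff']
    intro x
    obtain ⟨p, rfl⟩ := hΦ x
    exact ⟨p, p.2, hΨΦ p p.2⟩

theorem finite_wordLE (ht : t ≠ ⊤) : Finite (WordLE n t) := by
  lift t to ℕ using ht
  have : {l : List (Fin n) | l.length ≤ t}.Finite := List.finite_length_le _ _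
  refine Set.Finite.subset this fun w hw => ?_
  exact Nat.cast_le.1 (show ((FreeMonoid.length w : ℕ) : ℕ∞) ≤ t from hw)

/-- Pairing with the vectors Φ(w), |w| ≤ s, maps Φ(`degLE n s`) onto the column space of M_s. If s =
t and these vectors span ℝ^d, the pairing is injective. -/
theorem finrank_span_col_le {M : NCPoly n →ₗ[ℝ] ℝ} {L : Functional n (2 * t)}
    (hML : ∀ p (h : p ∈ degLE n (2 * t)), M p = L ⟨p, h⟩) {d : ℕ}
    {Φ : NCPoly n →ₗ[ℝ] (Fin d → ℝ)} (hΦ : IsGram M t Φ) {s : ℕ∞} (hst : s ≤ t) :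
    Module.finrank ℝ (Submodule.span ℝ (Set.range (momentMatrix L s hst).col)) ≤
        Module.finrank ℝ ((degLE n s).map Φ) ∧
      (s = t → (degLE n t).map Φ = ⊤ →
        Module.finrank ℝ (Submodule.span ℝ (Set.range (momentMatrix L s hst).col)) = d) := by
  let T : (Fin d → ℝ) →ₗ[ℝ] (WordLE n s → ℝ) := LinearMap.pi fun v =>
    dotProductBilin ℝ ℝ (Φ (monomial v.1))
  have hmap : ((degLE n s).map Φ).map T =
      Submodule.span ℝ (Set.range (momentMatrix L s hst).col) := by
    rw [← map_momentMap_degLE hML, ← Submodule.map_comp]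
    refine SetLike.coe_injective (Set.image_congr fun p hp => ?_)
    funext v
    exact hΦ _ (monomial_mem (v.2.trans hst)) _ (degLE_mono hst hp)
  rw [← hmap]
  refine ⟨Submodule.finrank_map_le _ _, ?_⟩
  rintro rfl htop
  have hinj : Function.Injective T := by
    rw [← LinearMap.ker_eq_bot, LinearMap.ker_eq_bot']
    intro x hx
    have hle : degLE n s ≤ LinearMap.ker ((dotProductBilin ℝ ℝ x) ∘ₗ Φ) := by
      refine Submodule.span_le.2 ?_
      rintro _ ⟨w, hw, rfl⟩
      change x ⬝ᵥ Φ (monomial w) = 0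
      rw [dotProduct_comm]
      exact congrFun hx ⟨w, hw⟩
    obtain ⟨p, hp, hpx⟩ : x ∈ (degLE n s).map Φ := htop ▸ Submodule.mem_top
    have h0 : x ⬝ᵥ Φ p = 0 := hle hp
    rw [hpx] at h0
    exact dotProduct_self_eq_zero.1 h0
  rw [(Submodule.equivMapOfInjective T hinj _).finrank_eq.symm, htop, finrank_top, Module.finrank_fin_fun]

/-- For finite t, flatness gives rank M_{t-δ} = d, and this rank is at most the dimension of
Φ(`degLE n (t - δ)`), which is therefore all of ℝ^d. For t = ∞ take s = ∞. -/
theorem IsFlat.exists_gram {L : Functional n (2 * t)} (hL : Feasible A L) (hf : IsFlat L) :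
    ∃ (M : NCPoly n →ₗ[ℝ] ℝ) (s : ℕ∞) (d : ℕ) (Φ : NCPoly n →ₗ[ℝ] (Fin d → ℝ)),
      TruncatedFeasible A t M ∧ (∀ p (h : p ∈ degLE n (2 * t)), M p = L ⟨p, h⟩) ∧
        s + 1 ≤ t ∧ IsGram M t Φ ∧ (degLE n s).map Φ = ⊤ := by
  obtain ⟨M, hM, hML⟩ := hL.exists_extension
  have hfin : FiniteDimensional ℝ ((degLE n t).map (momentMap M t)) := by
    rw [map_momentMap_degLE hML le_rfl]
    rcases hf with ⟨-, hr⟩ | ⟨ht, -⟩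
    · exact (eRank_lt_top_iff _).1 hr
    · have := finite_wordLE (n := n) ht
      infer_instance
  obtain ⟨d, Φ, hΦ, htop⟩ := hM.exists_isGram hfin
  rcases hf with ⟨rfl, -⟩ | ⟨ht, δ, hδ, hδt, hflat⟩
  · exact ⟨M, ⊤, d, Φ, hM, hML, by simp, hΦ, htop⟩
  · refine ⟨M, t - δ, d, Φ, hM, hML, ?_, hΦ, ?_⟩
    · lift t to ℕ using ht
      norm_cast at hδt ⊢
      omega
    · have h1 := congrArg ENat.toNat hflat
      rw [eRank_toNat_eq_finrank, eRank_toNat_eq_finrank,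
        (finrank_span_col_le hML hΦ le_rfl).2 rfl htop] at h1
      refine Submodule.eq_top_of_finrank_eq (le_antisymm (Submodule.finrank_le _) ?_)
      rw [Module.finrank_fin_fun]
      exact h1.le.trans (finrank_span_col_le hML hΦ tsub_le_self).1

end Extension

/-! ### Multiplication operators on the Gram space -/

section Operators

variable {n : ℕ} {A : Matrix (Fin n) (Fin n) ℝ} {t s : ℕ∞} {M : NCPoly n →ₗ[ℝ] ℝ} {d : ℕ}
  {Φ : NCPoly n →ₗ[ℝ] (Fin d → ℝ)}

theorem eq_of_dotProduct_eq (htop : (degLE n s).map Φ = ⊤) {x y : Fin d → ℝ}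
    (h : ∀ q ∈ degLE n s, x ⬝ᵥ Φ q = y ⬝ᵥ Φ q) : x = y := by
  refine dotProduct_eq _ _ fun z => ?_
  obtain ⟨q, hq, rfl⟩ : z ∈ (degLE n s).map Φ := htop ▸ Submodule.mem_top
  exact h q hq

/-- A symmetric operation on polynomials induces a symmetric matrix on the Gram space. -/
theorem IsGram.exists_matrix (hΦ : IsGram M t Φ) (hst : s ≤ t) (htop : (degLE n s).map Φ = ⊤)
    (m : NCPoly n →ₗ[ℝ] NCPoly n) (hm : ∀ p ∈ degLE n s, m p ∈ degLE n t)
    (hadj : ∀ p ∈ degLE n s, ∀ q ∈ degLE n s, M (star (m p) * q) = M (star p * m q)) :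
    ∃ O : Matrix (Fin d) (Fin d) ℝ, O.IsHermitian ∧ ∀ p ∈ degLE n s, O *ᵥ Φ p = Φ (m p) := by
  have hsurj : LinearMap.range (Φ.domRestrict (degLE n s)) = ⊤ := by
    rw [LinearMap.range_domRestrict, htop]
  -- `σ` is an arbitrary linear section of Φ; adjointness makes the operator `o` independent of this
  -- choice.
  obtain ⟨σ, hσ⟩ := (Φ.domRestrict (degLE n s)).exists_rightInverse_of_surjective hsurj
  have hσ' : ∀ x, Φ (σ x) = x := fun x => DFunLike.congr_fun hσ x
  let o : (Fin d → ℝ) →ₗ[ℝ] (Fin d → ℝ) := Φ ∘ₗ m ∘ₗ (degLE n s).subtype ∘ₗ σ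
  have hadjΦ : ∀ p ∈ degLE n s, ∀ q ∈ degLE n s, Φ (m p) ⬝ᵥ Φ q = Φ p ⬝ᵥ Φ (m q) := by
    intro p hp q hq
    rw [hΦ _ (hm p hp) _ (degLE_mono hst hq), hΦ _ (degLE_mono hst hp) _ (hm q hq),
      hadj p hp q hq]
  have ho : ∀ p ∈ degLE n s, o (Φ p) = Φ (m p) := by
    intro p hp
    refine eq_of_dotProduct_eq htop fun q hq => ?_
    change Φ (m (σ (Φ p))) ⬝ᵥ Φ q = _
    rw [hadjΦ _ (σ _).2 q hq, hσ', hadjΦ p hp q hq]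
  have hosymm : ∀ x y, o x ⬝ᵥ y = x ⬝ᵥ o y := by
    intro x y
    rw [← hσ' x, ← hσ' y, ho _ (σ _).2, ho _ (σ _).2, hadjΦ _ (σ _).2 _ (σ _).2]
  refine ⟨LinearMap.toMatrix' o, ?_, fun p hp => ?_⟩
  · ext a b
    have h := hosymm (Pi.single a 1) (Pi.single b 1)
    rw [dotProduct_single_one, single_one_dotProduct] at h
    simp only [conjTranspose_apply, star_trivial, LinearMap.toMatrix'_apply]
    exact h
  · rw [LinearMap.toMatrix'_mulVec, ho p hp]

theorem dotProduct_mulVec_symm {O : Matrix (Fin d) (Fin d) ℝ} (hO : O.IsHermitian)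
    (x y : Fin d → ℝ) : (O *ᵥ x) ⬝ᵥ y = x ⬝ᵥ (O *ᵥ y) := by
  rw [dotProduct_mulVec, ← vecMul_transpose, ← conjTranspose_eq_transpose_of_trivial, hO.eq]

/-- A vector functional is tracial as soon as the generators act on the vector like symmetric
operators in the commutant. -/
theorem vectorFunctional_mul_comm {X R : Fin n → Matrix (Fin d) (Fin d) ℝ} {v : Fin d → ℝ}
    (hX : ∀ i, (X i).IsHermitian) (hR : ∀ i, (R i).IsHermitian)
    (hcomm : ∀ i j, Commute (R i) (X j)) (hv : ∀ i, X i *ᵥ v = R i *ᵥ v) (p q : NCPoly n) :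
    vectorFunctional X v (p * q) = vectorFunctional X v (q * p) := by
  have hdef : ∀ p, vectorFunctional X v p = v ⬝ᵥ (eval X p *ᵥ v) := fun p => rfl
  have hRe : ∀ i p, Commute (R i) (eval X p) := by
    intro i p
    refine FreeAlgebra.induction ℝ (Fin n) (motive := fun p => Commute (R i) (eval X p))
      ?_ ?_ ?_ ?_ p
    · intro r
      rw [AlgHom.commutes]
      exact (Algebra.commutes r (R i)).symm
    · intro j
      exact (eval_var X j).symm ▸ hcomm i j
    · intro p q hp hq
      rw [map_mul]
      exact hp.mul_right hq
    · intro p q hp hq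
      rw [map_add]
      exact hp.add_right hq
  refine FreeAlgebra.induction ℝ (Fin n) (motive := fun p => ∀ q,
    vectorFunctional X v (p * q) = vectorFunctional X v (q * p)) ?_ ?_ ?_ ?_ p q
  · intro r q
    rw [Algebra.commutes]
  · intro i q
    change vectorFunctional X v (var i * q) = vectorFunctional X v (q * var i)
    -- ⟨v, X_i q v⟩ = ⟨X_i v, q v⟩ = ⟨R_i v, q v⟩ = ⟨v, q R_i v⟩ = ⟨v, q X_i v⟩.
    rw [hdef, hdef, map_mul (eval X), map_mul (eval X), eval_var, ← mulVec_mulVec,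
      ← mulVec_mulVec, ← dotProduct_mulVec_symm (hX i), hv i, dotProduct_mulVec_symm (hR i),
      mulVec_mulVec, mulVec_mulVec, (hRe i q).eq]
  · intro p p' hp hp' q
    rw [mul_assoc, hp, mul_assoc, hp', mul_assoc]
  · intro p p' hp hp' q
    rw [add_mul, mul_add, map_add, map_add, hp, hp']

/-- `M` is tracial only in bounded degree; full traciality of the new functional comes from the
commuting operators, and agreement with `M` is needed only at 1 and x_i x_j. -/
theorem TruncatedFeasible.exists_conic (hM : TruncatedFeasible A t M) (hst : s + 1 ≤ t)
    (hΦ : IsGram M t Φ) (htop : (degLE n s).map Φ = ⊤) :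
    ∃ L ∈ conicTraceEvals (localizing A), (∀ i j, A i j = L (var i * var j)) ∧ L 1 = M 1 := by
  have hs : s ≤ t := le_self_add.trans hst
  have ht : 1 ≤ t := le_add_self.trans hst
  have hleft : ∀ i, ∀ p ∈ degLE n s, var i * p ∈ degLE n t := fun i p hp =>
    mul_mem_degLE (var_mem_degLE le_rfl i) hp (by rwa [add_comm])
  have hright : ∀ i, ∀ p ∈ degLE n s, p * var i ∈ degLE n t := fun i p hp =>
    mul_mem_degLE hp (var_mem_degLE le_rfl i) hst
  have h2t : t + t ≤ 2 * t := (two_mul t).ge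
  -- In each cyclic exchange below one factor has degree at most s, which makes room for the extra
  -- variable.
  have h12 : 1 + (s + t) ≤ 2 * t := by
    rw [← add_assoc, add_comm 1 s]
    exact (add_le_add_left hst t).trans h2t
  have hXex : ∀ i : Fin n, ∃ O : Matrix (Fin d) (Fin d) ℝ, O.IsHermitian ∧
      ∀ p ∈ degLE n s, O *ᵥ Φ p = Φ (var i * p) := fun i =>
    hΦ.exists_matrix hs htop (LinearMap.mulLeft ℝ (var i)) (hleft i) fun p _ q _ => by
      simp [mul_assoc]
  have hRex : ∀ i : Fin n, ∃ O : Matrix (Fin d) (Fin d) ℝ, O.IsHermitian ∧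
      ∀ p ∈ degLE n s, O *ᵥ Φ p = Φ (p * var i) := fun i =>
    hΦ.exists_matrix hs htop (LinearMap.mulRight ℝ (var i)) (hright i) fun p hp q hq => by
      rw [LinearMap.mulRight_apply, LinearMap.mulRight_apply, star_mul, star_var, mul_assoc,
        hM.mul_comm 1 (s + t) h12 _ (var_mem_degLE le_rfl i) _
          (mul_mem_degLE (star_mem_degLE hp) (degLE_mono hs hq) le_rfl), mul_assoc]
  choose X hXh hX using hXex
  choose R hRh hR using hRex
  have h1 : (1 : NCPoly n) ∈ degLE n s := one_mem
  have hcomm : ∀ i j, Commute (R i) (X j) := by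
    intro i j
    refine Matrix.ext_of_mulVec_single fun a => ?_
    generalize (Pi.single a 1 : Fin d → ℝ) = x
    obtain ⟨p, hp, rfl⟩ : x ∈ (degLE n s).map Φ := htop ▸ Submodule.mem_top
    refine eq_of_dotProduct_eq htop fun q hq => ?_
    rw [← mulVec_mulVec, ← mulVec_mulVec, dotProduct_mulVec_symm (hRh i),
      dotProduct_mulVec_symm (hXh j) (R i *ᵥ Φ p), hX j p hp, hX j q hq, hR i p hp, hR i q hq,
      hΦ _ (hleft j p hp) _ (hright i q hq), hΦ _ (hright i p hp) _ (hleft j q hq),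
      star_mul, star_mul, star_var, star_var, mul_assoc (var i),
      hM.mul_comm 1 (s + t) h12 _ (var_mem_degLE le_rfl i) _
          (mul_mem_degLE (star_mem_degLE hp) (hleft j q hq) le_rfl)]
    simp only [mul_assoc]
  have hX1 : ∀ i, X i *ᵥ Φ 1 = Φ (var i) := fun i => by rw [hX i 1 h1, mul_one]
  have hR1 : ∀ i, R i *ᵥ Φ 1 = Φ (var i) := fun i => by rw [hR i 1 h1, one_mul]
  refine ⟨vectorFunctional X (Φ 1), vectorFunctional_mem_conicTraceEvals hXh
    (vectorFunctional_mul_comm hXh hRh hcomm fun i => by rw [hX1, hR1]) ?_, fun i j => ?_, ?_⟩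
  · rintro _ ⟨i, rfl⟩
    have hev : eval X (Real.sqrt (A i i) • var i - var i ^ 2) =
        Real.sqrt (A i i) • X i - X i * X i := by
      simp [sq]
    rw [hev]
    refine Matrix.PosSemidef.of_dotProduct_mulVec_nonneg ?_ fun x => ?_
    · change _ᴴ = _
      rw [conjTranspose_sub, conjTranspose_smul, conjTranspose_mul, (hXh i).eq, star_trivial]
    · obtain ⟨p, hp, rfl⟩ : x ∈ (degLE n s).map Φ := htop ▸ Submodule.mem_top
      have hpt := degLE_mono hs hp
      have hstar := star_mem_degLE hp
      have hv := hleft i p hp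
      -- Grouping x_i with p keeps both Gram factors within degree t, so ⟨x, g(X) x⟩ becomes M(p* g
      -- p).
      have hexp : star p * (Real.sqrt (A i i) • var i - var i ^ 2) * p =
          Real.sqrt (A i i) • (star p * (var i * p)) - star (var i * p) * (var i * p) := by
        rw [star_mul, star_var, sq, mul_sub, sub_mul, mul_smul_comm, smul_mul_assoc]
        simp only [mul_assoc]
      have hpos := hM.nonneg p _ (Set.mem_insert_of_mem _ ⟨i, rfl⟩) (by
        rw [hexp]
        exact sub_mem (Submodule.smul_mem _ _ (mul_mem_degLE (degLE_mono hs hstar) hv h2t))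
          (mul_mem_degLE (star_mem_degLE hv) hv h2t))
      rw [hexp, map_sub, map_smul, ← hΦ _ hpt _ hv, ← hΦ _ hv _ hv, ← hX i p hp] at hpos
      rw [star_trivial, sub_mulVec, smul_mulVec, dotProduct_sub, dotProduct_smul,
        ← mulVec_mulVec, ← dotProduct_mulVec_symm (hXh i) (Φ p) (X i *ᵥ Φ p)]
      exact hpos
  · change _ = Φ 1 ⬝ᵥ (eval X (var i * var j) *ᵥ Φ 1)
    rw [map_mul (eval X), eval_var, eval_var, ← mulVec_mulVec, ← dotProduct_mulVec_symm (hXh i),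
      hX1, hX1, hΦ _ (var_mem_degLE ht i) _ (var_mem_degLE ht j), star_var, hM.moments]
  · change Φ 1 ⬝ᵥ (eval X 1 *ᵥ Φ 1) = M 1
    rw [map_one (eval X), one_mulVec, hΦ _ one_mem _ one_mem, star_one, one_mul]

end Operators

theorem IsFlat.exists_conic {n : ℕ} {A : Matrix (Fin n) (Fin n) ℝ} {t : ℕ∞}
    {L : Functional n (2 * t)} (hL : Feasible A L) (hf : IsFlat L) :
    ∃ K ∈ conicTraceEvals (localizing A), (∀ i j, A i j = K (var i * var j)) ∧
      atOne L = K 1 := by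
  obtain ⟨M, s, d, Φ, hM, hML, hst, hΦ, htop⟩ := hf.exists_gram hL
  obtain ⟨K, hK, hKA, hK1⟩ := hM.exists_conic hst hΦ htop
  exact ⟨K, hK, hKA, by rw [hK1, hML 1 one_mem]; rfl⟩

end CPSD

end

theorem proposition2 {n : ℕ} (A : Matrix (Fin n) (Fin n) ℝ) (hA : CPSD.IsCPSD A) :
    CPSD.xiStar A =
        CPSD.extInf {r | ∃ L ∈ CPSD.conicTraceEvals (CPSD.localizing A),
          (∀ i j, A i j = L (CPSD.var i * CPSD.var j)) ∧ r = L 1} ∧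
      CPSD.xiStar A = CPSD.extInf {α | 0 ≤ α ∧ CPSD.HasTracialRep.{u} A α} ∧
      ∀ t : ℕ∞, 1 ≤ t →
        (∃ L : CPSD.Functional n (2 * t), CPSD.IsOptimal A L ∧ CPSD.IsFlat L) →
          CPSD.xi t A = CPSD.xiStar A := by
  let star : Set ℝ := {r | ∃ L : CPSD.Functional n (2 * ⊤),
    CPSD.Feasible A L ∧ CPSD.HasFiniteRank L ∧ r = CPSD.atOne L}
  let conic : Set ℝ := {r | ∃ L ∈ CPSD.conicTraceEvals (CPSD.localizing A),
    (∀ i j, A i j = L (CPSD.var i * CPSD.var j)) ∧ r = L 1}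
  let rep : Set ℝ := {α | 0 ≤ α ∧ CPSD.HasTracialRep.{u} A α}
  have h12 : star ⊆ conic := by
    rintro r ⟨L, hL, hr, rfl⟩
    exact CPSD.IsFlat.exists_conic hL (Or.inl ⟨rfl, hr⟩)
  have h23 : conic ⊆ rep := by
    rintro r ⟨L, hL, hLA, rfl⟩
    exact CPSD.hasTracialRep_of_mem_conicTraceEvals hL hLA
  have h31 : rep ⊆ star := by
    rintro r ⟨hr, hrep⟩
    exact CPSD.feasible_of_hasTracialRep hr hrep
  have e12 : star = conic := h12.antisymm (h23.trans h31)
  have e13 : star = rep := (h12.trans h23).antisymm h31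
  refine ⟨congrArg CPSD.extInf e12, congrArg CPSD.extInf e13, ?_⟩
  rintro t ht ⟨L, ⟨hL, hopt⟩, hflat⟩
  refine le_antisymm (sInf_le_sInf (Set.image_mono ?_)) (le_sInf ?_)
  · rintro r ⟨K, hK, -, rfl⟩
    obtain ⟨K', hK', h1⟩ := hK.restrict ht le_top
    exact ⟨K', hK', h1.symm⟩
  · rintro _ ⟨r, ⟨K, hK, rfl⟩, rfl⟩
    have hmem : CPSD.atOne L ∈ star := e12 ▸ CPSD.IsFlat.exists_conic hL hflat
    exact (sInf_le (Set.mem_image_of_mem _ hmem)).trans (EReal.coe_le_coe_iff.2 (hopt K hK))
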